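/- **Setting.** Let $G=(V,E)$ be a finite directed graph with $n=|V|$ nodes, known to all nodes, and let $f$ be an integer with $n>f>0$. *Graph condition.* For $F\subseteq V$ let $G_F$ be the subgraph of $G$ induced by $V\setminus F$. For $u\in V\setminus F$ let $\mathrm{reach}_u(F)$ be the set of nodes $w\in V\setminus F$ from which there is a directed path (possibly of length zero) to $u$ in $G_F$. The graph $G$ satisfies the *1-reach condition with parameter $\rho$* if $|\mathrm{reach}_u(F)\cap \mathrm{reach}_v(F)|\ge \rho$ for every $F\subseteq V$ with $|F|\le f$ and all (not necessarily distinct) $u,v\in V\setminus F$. *Authenticated messages.* Messages are terms built from cleartext data (encoded by natural numbers) by pairing and by signing; $m^u$ denotes the message $m$ together with the signature of node $u$ on it. Whoever holds the private keys of the nodes in $K$ and has seen the messages in $\mathcal S$ can compose exactly the messages obtained from $\mathcal S$ and cleartext data by forming and splitting pairs, reading $m$ from a signed message $m^u$, and signing by nodes $u\in K$. In particular, a signature of a node outside $K$ can only be copied. *Synchronous algorithms.* The system runs in rounds $0,1,2,\dots$. In each round, each node may send to each of its outgoing neighbours one (composite) message, received in the same round. A deterministic algorithm prescribes, for each node $v$,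 as functions of its input $x_v\in\{0,1\}$ and of the messages it received in all earlier rounds, the messages it sends in the next round and its decision (an element of $\{0,1\}$, or none yet). A node may only send messages that can be composed with its own private key from the messages it has received. The output of a node is its first decision. *Faults.* In an execution, a set $F^*\subseteq V$ with $|F^*|\le f$ is Byzantine faulty. Nodes outside $F^*$ follow the algorithm. The faulty nodes collude and behave arbitrarily: in each round $r$, each of them sends to each of its outgoing neighbours nothing, or any message that can be composed with the private keys of the nodes in $F^*$ from the messages that nodes in $F^*$ have received from nodes outside $F^*$ in rounds $0,\dots,r$. *Exact Byzantine consensus with authentication is possible* in the synchronous system on $G$ if there is an algorithm such that for every choice of inputs, every $F^*$ with $|F^*|\le f$, and every execution: (termination) each non-faulty node eventually outputs a value; (validity) the output of each non-faulty node equals the input of some non-faulty node; (agreement) all non-faulty nodes have the same output. **Theorem.** Exact Byzantine consensus with authentication in the presence of up to $f$ Byzantine faulty nodes is possible in the synchronous system on $G$ if and only if $G$ satisfies the 1-reach condition with $\rho=f+1$. -/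

import Mathlib

/-! ### The graph condition -/

/-- `G_F`: the subgraph of `G` induced by `V - F`. The vertex type is kept; the nodes of `F`
are isolated in it. -/
def removeNodes {V : Type*} (G : Digraph V) (F : Finset V) : Digraph V where
  Adj a b := G.Adj a b ∧ a ∉ F ∧ b ∉ F

/-- `reach_u(F)`, for `u ∉ F`: the nodes of `V - F` that have a directed path (possibly of
length zero) to `u` in `G_F`. -/
def reach {V : Type*} (G : Digraph V) (F : Finset V) (u : V) : Set V :=
  {w | w ∉ F ∧ Relation.ReflTransGen (removeNodes G F).Adj w u}

/-- The 1-reach condition with parameter `ρ`, for at most `f` faulty nodes. -/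
def OneReach {V : Type*} (G : Digraph V) (f ρ : ℕ) : Prop :=
  ∀ F : Finset V, F.card ≤ f → ∀ u v : V, u ∉ F → v ∉ F →
    ρ ≤ (reach G F u ∩ reach G F v).ncard

/-! ### Authenticated messages -/

/-- Messages. `data` is unsigned cleartext (encoded by a number), `pair` is concatenation, and
`sign u m` is the message `m` (in clear) together with the signature of node `u` on it. -/
inductive Msg (V : Type*) where
  | data (k : ℕ) : Msg V
  | pair (m₁ m₂ : Msg V) : Msg V
  | sign (u : V) (m : Msg V) : Msg V

/-- `Derivable K S m`: the message `m` can be composed by someone who holds the private keys of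
exactly the nodes in `K` and who has seen exactly the messages in `S`. A message signed by a node
outside `K` can therefore only be copied from the messages in `S`. -/
inductive Derivable {V : Type*} (K : Set V) (S : Set (Msg V)) : Msg V → Prop
  | known {m : Msg V} : m ∈ S → Derivable K S m
  | data (k : ℕ) : Derivable K S (Msg.data k)
  | pair {m₁ m₂ : Msg V} : Derivable K S m₁ → Derivable K S m₂ → Derivable K S (Msg.pair m₁ m₂)
  | left {m₁ m₂ : Msg V} : Derivable K S (Msg.pair m₁ m₂) → Derivable K S m₁
  | right {m₁ m₂ : Msg V} : Derivable K S (Msg.pair m₁ m₂) → Derivable K S m₂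
  | sign {u : V} {m : Msg V} : u ∈ K → Derivable K S m → Derivable K S (Msg.sign u m)
  | content {u : V} {m : Msg V} : Derivable K S (Msg.sign u m) → Derivable K S m

/-! ### Synchronous algorithms and their executions -/

/-- What a node receives in one round: from each node one (composite) message, or nothing. -/
abbrev Inbox (V : Type*) := V → Option (Msg V)

/-- The messages that occur in a list of inboxes. -/
def received {V : Type*} (h : List (Inbox V)) : Set (Msg V) :=
  {m | ∃ i ∈ h, ∃ u : V, i u = some m}

/-- A deterministic synchronous algorithm with authentication. The program of node `v` sees the
input of `v` and the inboxes of all earlier rounds, oldest first; from these it computes the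
message to each node in the next round, and its decision, if any. A node can sign
only with its own key; any other signature that it sends has been received by it before. -/
structure SyncAlgorithm (V : Type*) where
  send : V → Bool → List (Inbox V) → V → Option (Msg V)
  decide : V → Bool → List (Inbox V) → Option Bool
  send_derivable : ∀ (v : V) (x : Bool) (h : List (Inbox V)) (w : V) (m : Msg V),
    send v x h w = some m → Derivable {v} (received h) m

/-- A transcript: `T r u w` is the message that `u` sends to `w`, and that `w` receives, in
round `r = 0, 1, 2, …`. -/
abbrev Transcript (V : Type*) := ℕ → V → V → Option (Msg V)

/-- The inboxes of node `v` in rounds `0, …, r - 1`. -/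
def history {V : Type*} (T : Transcript V) (v : V) (r : ℕ) : List (Inbox V) :=
  (List.range r).map fun s u => T s u v

/-- The messages that some node of `F` receives from a node outside `F` in rounds `0, …, r`. -/
def seenBy {V : Type*} (F : Finset V) (T : Transcript V) (r : ℕ) : Set (Msg V) :=
  {m | ∃ s ≤ r, ∃ u ∉ F, ∃ w ∈ F, T s u w = some m}

/-- `T` is an execution of `A` on `G` with inputs `x` and with `F` as the set of Byzantine nodes.
The faulty nodes collude and deviate arbitrarily, round by round: they may send, to each
outgoing neighbour, nothing or anything that they can compose with their own keys from the
messages that they have received. -/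
structure IsExecution {V : Type*} (G : Digraph V) (A : SyncAlgorithm V) (F : Finset V)
    (x : V → Bool) (T : Transcript V) : Prop where
  no_link : ∀ (r : ℕ) (u w : V), ¬ G.Adj u w → T r u w = none
  nonfaulty : ∀ (r : ℕ) (u w : V), u ∉ F → G.Adj u w →
    T r u w = A.send u (x u) (history T u r) w
  faulty : ∀ (r : ℕ) (u w : V) (m : Msg V), u ∈ F → T r u w = some m →
    Derivable (↑F : Set V) (seenBy F T r) m

/-- In the transcript `T`, the output of node `v` is `b`: this is its first decision. -/
def Outputs {V : Type*} (A : SyncAlgorithm V) (x : V → Bool) (T : Transcript V)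
    (v : V) (b : Bool) : Prop :=
  ∃ r : ℕ, A.decide v (x v) (history T v r) = some b ∧
    ∀ s < r, A.decide v (x v) (history T v s) = none

/-- `A` achieves exact Byzantine consensus on `G` in the presence of up to `f` faulty nodes. -/
def SolvesConsensus {V : Type*} (G : Digraph V) (f : ℕ) (A : SyncAlgorithm V) : Prop :=
  ∀ (F : Finset V) (x : V → Bool) (T : Transcript V), F.card ≤ f → IsExecution G A F x T →
    -- termination
    (∀ v ∉ F, ∃ b, Outputs A x T v b) ∧
    -- validity
    (∀ v ∉ F, ∀ b, Outputs A x T v b → ∃ u ∉ F, x u = b) ∧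
    -- agreement
    (∀ u ∉ F, ∀ v ∉ F, ∀ b c, Outputs A x T u b → Outputs A x T v c → b = c)

/-- Exact Byzantine consensus with authentication is possible on the synchronous network `G`. -/
def SyncConsensusPossible {V : Type*} (G : Digraph V) (f : ℕ) : Prop :=
  ∃ A : SyncAlgorithm V, SolvesConsensus G f A

/-! Necessity is an indistinguishability argument. Suppose that `C`, the intersection of `reach G F
u` and `reach G F v`, has at most `f` nodes. All in-neighbours of `C` outside `F` lie in `C`. If `C`
is empty, a silent `F` lets the two disjoint reach sets decide on opposite inputs. Otherwise let `C`
have input 0 and all other nodes 1. If `F` is silent towards `C` (`dropRun`), then `C` outputs 0,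
and by agreement so does any node outside `F ∪ C`. That node sees the same when `C` is faulty and
ignores `F` (`ignoreRun`), where validity demands 1. If there is no such node, the fault-free run
already gives a contradiction.

For sufficiency, `lt_card_roots` yields, for every candidate fault set, more than `f` nodes that
reach all nodes outside it. There is a phase for each candidate: signed values are flooded, then
signed reports of the values heard, and the majority is taken over what the roots of the candidate
report. For the true fault set all roots are honest and heard by everyone, so all nodes evaluate the
same set (`updatedValue_of_faulty`). For any candidate, unanimity survives
(`updatedValue_of_unanimous`): signatures cannot be forged, so at most `f` nodes seem to dissent,
while an honest root of the candidate reports more than `f` honest values. -/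

/-! ### Transcripts -/

theorem history_succ {V : Type*} (T : Transcript V) (v : V) (r : ℕ) :
    history T v (r + 1) = history T v r ++ [fun u => T r u v] := by
  simp [history, List.range_succ]

theorem mem_received_history {V : Type*} {T : Transcript V} {v : V} {r : ℕ} {m : Msg V} :
    m ∈ received (history T v r) ↔ ∃ s < r, ∃ u, T s u v = some m := by
  simp [received, history]

theorem history_congr {V : Type*} {T T' : Transcript V} {v : V}
    (h : ∀ r u, T r u v = T' r u v) (r : ℕ) : history T v r = history T' v r := by
  simp [history, h]

theorem Outputs.congr {V : Type*} {A : SyncAlgorithm V} {x x' : V → Bool} {T T' : Transcript V}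
    {v : V} {b : Bool} (hx : x v = x' v) (hT : ∀ r, history T v r = history T' v r)
    (h : Outputs A x T v b) : Outputs A x' T' v b := by
  simpa only [Outputs, hx, hT] using h

theorem Derivable.trans {V : Type*} {K K' : Set V} {S S' : Set (Msg V)} {m : Msg V}
    (hK : K ⊆ K') (hS : ∀ s ∈ S, Derivable K' S' s) (h : Derivable K S m) :
    Derivable K' S' m := by
  induction h with
  | known h => exact hS _ h
  | data k => exact .data k
  | pair _ _ h₁ h₂ => exact .pair h₁ h₂
  | left _ h => exact .left h
  | right _ h => exact .right h
  | sign hu _ h => exact .sign (hK hu) h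
  | content _ h => exact .content h

theorem seenBy_mono {V : Type*} (F : Finset V) (T : Transcript V) {r s : ℕ} (h : r ≤ s) :
    seenBy F T r ⊆ seenBy F T s := by
  rintro m ⟨t, ht, hm⟩
  exact ⟨t, ht.trans h, hm⟩

/-- If every faulty node only uses its own key and the messages that it has received, then the
faulty nodes together satisfy the constraint on their messages. -/
theorem derivable_seenBy {V : Type*} {F : Finset V} {T : Transcript V}
    (h : ∀ r, ∀ u ∈ F, ∀ w m, T r u w = some m → Derivable {u} (received (history T u r)) m)
    (r : ℕ) : ∀ u ∈ F, ∀ w m, T r u w = some m → Derivable (↑F : Set V) (seenBy F T r) m := by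
  induction r using Nat.strong_induction_on with
  | _ r ih =>
    intro u hu w m hm
    refine (h r u hu w m hm).trans (by simpa using hu) fun a ha => ?_
    obtain ⟨s, hs, v, hv⟩ := mem_received_history.1 ha
    -- Messages passed inside `F` are not in `seenBy`; they are replaced by their own derivations
    -- from earlier rounds.
    by_cases hvF : v ∈ F
    · exact (ih s hs v hvF u a hv).trans subset_rfl
        fun b hb => .known (seenBy_mono F T hs.le hb)
    · exact .known ⟨s, hs.le, v, hvF, u, hu, hv⟩

/-! ### Necessity of the graph condition -/

open Classical in
/-- The histories that arise when all nodes follow `A`, but the links from `F` to `D` are down. -/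
noncomputable def dropHistory {V : Type*} (G : Digraph V) (A : SyncAlgorithm V) (F D : Finset V)
    (x : V → Bool) : ℕ → V → List (Inbox V)
  | 0, _ => []
  | r + 1, w => dropHistory G A F D x r w ++
      [fun u => if G.Adj u w ∧ ¬ (u ∈ F ∧ w ∈ D) then
        A.send u (x u) (dropHistory G A F D x r u) w else none]

open Classical in
/-- All nodes follow `A`, but the links from `F` to `D` are down. -/
noncomputable def dropRun {V : Type*} (G : Digraph V) (A : SyncAlgorithm V) (F D : Finset V)
    (x : V → Bool) : Transcript V := fun r u w =>
  if G.Adj u w ∧ ¬ (u ∈ F ∧ w ∈ D) then A.send u (x u) (dropHistory G A F D x r u) w else none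

open Classical in
/-- All nodes follow `A`, but the nodes of `D` ignore what they receive from `F`. -/
noncomputable def ignoreRun {V : Type*} (G : Digraph V) (A : SyncAlgorithm V) (F D : Finset V)
    (x : V → Bool) : Transcript V := fun r u w =>
  if G.Adj u w then A.send u (x u) (dropHistory G A F D x r u) w else none

section Necessity

variable {V : Type*} {G : Digraph V} {A : SyncAlgorithm V} {F D : Finset V} {x : V → Bool}

theorem history_dropRun (r : ℕ) (v : V) :
    history (dropRun G A F D x) v r = dropHistory G A F D x r v := by
  induction r with
  | zero => rfl
  | succ r ih => rw [history_succ, ih]; rfl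

theorem dropRun_eq_ignoreRun {r : ℕ} {u w : V} (h : w ∉ D) :
    dropRun G A F D x r u w = ignoreRun G A F D x r u w := by
  by_cases huw : G.Adj u w <;> simp [dropRun, ignoreRun, h, huw]

/-- Only senders on a cut link need be faulty. With `D` empty nothing is cut, so the fault-free run
is an execution for every choice of `F'`. -/
theorem dropRun_isExecution {F' : Finset V} (h : ∀ u ∈ F, ∀ w ∈ D, u ∈ F') :
    IsExecution G A F' x (dropRun G A F D x) where
  no_link r u w huw := by simp [dropRun, huw]
  nonfaulty r u w hu huw := by
    rw [history_dropRun, dropRun, if_pos]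
    exact ⟨huw, fun hd => hu (h u hd.1 w hd.2)⟩
  faulty r u w m hu hm := by
    refine derivable_seenBy (fun r u _ w m hm => ?_) r u hu w m hm
    rw [dropRun] at hm
    split_ifs at hm
    rw [history_dropRun]
    exact A.send_derivable _ _ _ _ _ hm

/-- Nodes of `D` act on a part of what they really receive, so they never need a signature that they
lack. -/
theorem ignoreRun_isExecution : IsExecution G A D x (ignoreRun G A F D x) where
  no_link r u w huw := by simp [ignoreRun, huw]
  nonfaulty r u w hu huw := by
    rw [← history_congr (fun _ _ => dropRun_eq_ignoreRun hu), history_dropRun, ignoreRun,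
      if_pos huw]
  faulty r u w m hu hm := by
    refine derivable_seenBy (fun r u _ w m hm => ?_) r u hu w m hm
    rw [ignoreRun] at hm
    split_ifs at hm
    refine (A.send_derivable _ _ _ _ _ hm).trans subset_rfl fun a ha => .known ?_
    rw [← history_dropRun, mem_received_history] at ha
    obtain ⟨s, hs, v, hv⟩ := ha
    rw [dropRun] at hv
    split_ifs at hv with h
    exact mem_received_history.2 ⟨s, hs, v, by rw [ignoreRun, if_pos h.1, hv]⟩

/-- Nodes that hear only from each other cannot notice what happens elsewhere. -/
theorem dropHistory_congr {D' : Finset V} {x' : V → Bool} {C : Set V}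
    (hC : ∀ a b, b ∈ C → G.Adj a b → a ∉ F → a ∈ C) (hCD : ∀ a ∈ C, a ∈ D)
    (hCD' : ∀ a ∈ C, a ∈ D') (hx : ∀ a ∈ C, x a = x' a) (r : ℕ) :
    ∀ v ∈ C, dropHistory G A F D x r v = dropHistory G A F D' x' r v := by
  induction r with
  | zero => intros; rfl
  | succ r ih =>
    intro v hv
    rw [dropHistory, dropHistory, ih v hv]
    congr 2
    funext u
    by_cases huv : G.Adj u v
    · by_cases hu : u ∈ F
      · simp [hu, hCD v hv, hCD' v hv]
      · have huC := hC u v hv huv hu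
        simp [hu, huv, ih u huC, hx u huC]
    · simp [huv]

theorem reach_closed {u a b : V} (hb : b ∈ reach G F u) (hab : G.Adj a b) (ha : a ∉ F) :
    a ∈ reach G F u :=
  ⟨ha, .head ⟨hab, ha, hb.1⟩ hb.2⟩

variable [Fintype V] {f : ℕ}

/-- If the nodes of `C` all have input `b` and hear only from each other, they output `b`. -/
theorem outputs_of_isolated (hA : SolvesConsensus G f A) (hF : F.card ≤ f) {C : Set V}
    (hC : ∀ a b, b ∈ C → G.Adj a b → a ∉ F → a ∈ C) (hCD : ∀ a ∈ C, a ∈ D)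
    (hCF : ∀ a ∈ C, a ∉ F) {b : Bool} (hx : ∀ a ∈ C, x a = b) {v : V} (hv : v ∈ C) :
    Outputs A x (dropRun G A F D x) v b := by
  -- In the comparison run all inputs are `b` and `F` is silent, so validity leaves no other output;
  -- `C` cannot tell the two runs apart.
  obtain ⟨hterm, hval, -⟩ := hA F (fun _ => b) (dropRun G A F Finset.univ fun _ => b) hF
    (dropRun_isExecution fun u hu _ _ => hu)
  obtain ⟨c, hc⟩ := hterm v (hCF v hv)
  obtain ⟨u, -, rfl⟩ := hval v (hCF v hv) c hc
  refine hc.congr (hx v hv).symm fun r => ?_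
  rw [history_dropRun, history_dropRun]
  exact dropHistory_congr hC (fun _ _ => Finset.mem_univ _) hCD
    (fun a ha => (hx a ha).symm) r v hv

theorem oneReach_of_solvesConsensus (hn : f < Fintype.card V) (hA : SolvesConsensus G f A) :
    OneReach G f (f + 1) := by
  classical
  intro F hF u v hu hv
  by_contra! hlt
  obtain ⟨C, hC⟩ : ∃ C : Finset V, (C : Set V) = reach G F u ∩ reach G F v :=
    ⟨(reach G F u ∩ reach G F v).toFinset, by simp⟩
  rw [← hC, Set.ncard_coe_finset, Nat.lt_succ_iff] at hlt
  have hmem : ∀ a, a ∈ C ↔ a ∈ reach G F u ∧ a ∈ reach G F v := fun a => by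
    rw [← Finset.mem_coe, hC, Set.mem_inter_iff]
  rcases C.eq_empty_or_nonempty with rfl | ⟨c, hc⟩
  · have hdisj : ∀ a ∈ reach G F v, a ∉ reach G F u := fun a hav hau => by
      simpa using (hmem a).2 ⟨hau, hav⟩
    let x : V → Bool := fun a => decide (a ∉ reach G F u)
    obtain ⟨-, -, hagree⟩ := hA F x (dropRun G A F Finset.univ x) hF
      (dropRun_isExecution fun u hu _ _ => hu)
    have h₁ : Outputs A x (dropRun G A F Finset.univ x) u false :=
      outputs_of_isolated hA hF (fun a b hb hab ha => reach_closed hb hab ha)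
        (fun _ _ => Finset.mem_univ _) (fun a ha => ha.1) (fun a ha => by simp [x, ha])
        (⟨hu, .refl⟩ : u ∈ reach G F u)
    have h₂ : Outputs A x (dropRun G A F Finset.univ x) v true :=
      outputs_of_isolated hA hF (fun a b hb hab ha => reach_closed hb hab ha)
        (fun _ _ => Finset.mem_univ _) (fun a ha => ha.1) (fun a ha => by simp [x, hdisj a ha])
        (⟨hv, .refl⟩ : v ∈ reach G F v)
    exact Bool.false_ne_true (hagree u hu v hv _ _ h₁ h₂)
  have hcF : c ∉ F := ((hmem c).1 hc).1.1
  let x : V → Bool := fun a => decide (a ∉ C)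
  by_cases hw : ∃ w, w ∉ F ∧ w ∉ C
  · obtain ⟨w, hwF, hwC⟩ := hw
    obtain ⟨hterm, -, hagree⟩ := hA F x (dropRun G A F C x) hF
      (dropRun_isExecution fun u hu _ _ => hu)
    obtain ⟨b, hb⟩ := hterm w hwF
    have h₁ : Outputs A x (dropRun G A F C x) c false :=
      outputs_of_isolated (C := C) hA hF
        (fun a b hb hab ha => (hmem a).2
          ⟨reach_closed ((hmem b).1 hb).1 hab ha, reach_closed ((hmem b).1 hb).2 hab ha⟩)
        (fun _ h => h) (fun a ha => ((hmem a).1 ha).1.1) (fun a ha => by simpa [x] using ha) hc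
    obtain rfl := hagree w hwF c hcF _ _ hb h₁
    obtain ⟨-, hval, -⟩ := hA C x (ignoreRun G A F C x) hlt ignoreRun_isExecution
    obtain ⟨z, hz, hxz⟩ := hval w hwC false
      (hb.congr rfl (history_congr fun _ _ => dropRun_eq_ignoreRun hwC))
    simp [x, hz] at hxz
  -- Here `V = F ∪ C`. In the fault-free run either `F` or `C` may be declared faulty: validity
  -- gives 0 in the first case and 1 in the second.
  · push Not at hw
    obtain ⟨d, hd⟩ : ∃ d, d ∉ C := by
      by_contra! h
      rw [Finset.eq_univ_iff_forall.2 h, Finset.card_univ] at hlt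
      omega
    have hdF : d ∈ F := by
      by_contra h
      exact hd (hw d h)
    have hex : ∀ F', IsExecution G A F' x (dropRun G A F ∅ x) := fun F' =>
      dropRun_isExecution (by simp)
    obtain ⟨hterm, -, hagree⟩ := hA ∅ x _ (by simp) (hex ∅)
    obtain ⟨b, hb⟩ := hterm c (by simp)
    obtain ⟨b', hb'⟩ := hterm d (by simp)
    obtain rfl := hagree c (by simp) d (by simp) _ _ hb hb'
    obtain ⟨y, hy, hxy⟩ := (hA F x _ hF (hex F)).2.1 c hcF _ hb
    obtain ⟨z, hz, hxz⟩ := (hA C x _ hlt (hex C)).2.1 d hd _ hb'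
    rw [← hxy] at hxz
    simp [x, hz, hw y hy] at hxz

end Necessity

/-! ### Signatures in composed messages -/

/-- All subterms of a message, including the message itself. -/
def Msg.subterms {V : Type*} : Msg V → List (Msg V)
  | .data k => [.data k]
  | .pair m₁ m₂ => .pair m₁ m₂ :: (m₁.subterms ++ m₂.subterms)
  | .sign u m => .sign u m :: m.subterms

theorem Msg.self_mem_subterms {V : Type*} (m : Msg V) : m ∈ m.subterms := by
  cases m <;> simp [Msg.subterms]

/-- A signature with a key outside `K` can only be copied. -/
theorem Derivable.exists_of_sign_mem_subterms {V : Type*} {K : Set V} {S : Set (Msg V)}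
    {m a : Msg V} {v : V} (h : Derivable K S m) (hv : v ∉ K) (ha : Msg.sign v a ∈ m.subterms) :
    ∃ s ∈ S, Msg.sign v a ∈ s.subterms := by
  induction h with
  | known h => exact ⟨_, h, ha⟩
  | data k => simp [Msg.subterms] at ha
  | pair _ _ h₁ h₂ =>
    simp only [Msg.subterms, List.mem_cons, reduceCtorEq, List.mem_append, false_or] at ha
    exact ha.elim h₁ h₂
  | left _ h => exact h (by simp [Msg.subterms, ha])
  | right _ h => exact h (by simp [Msg.subterms, ha])
  | sign hu _ h =>
    simp only [Msg.subterms, List.mem_cons, Msg.sign.injEq] at ha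
    rcases ha with ⟨rfl, -⟩ | ha
    · exact absurd hu hv
    · exact h ha
  | content _ h => exact h (by simp [Msg.subterms, ha])

/-- A list of messages as one message. -/
def Msg.ofList {V : Type*} : List (Msg V) → Msg V
  | [] => .data 0
  | m :: l => .pair m (Msg.ofList l)

theorem Derivable.ofList {V : Type*} {K : Set V} {S : Set (Msg V)} {l : List (Msg V)}
    (h : ∀ m ∈ l, Derivable K S m) : Derivable K S (Msg.ofList l) := by
  induction l with
  | nil => exact .data 0
  | cons m l ih =>
    exact .pair (h m (by simp)) (ih fun a ha => h a (by simp [ha]))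

/-- `t` can be read from some message of the list. -/
def Knows {V : Type*} (l : List (Msg V)) (t : Msg V) : Prop :=
  ∃ m ∈ l, t ∈ m.subterms

theorem Knows.mono {V : Type*} {l l' : List (Msg V)} {t : Msg V} (h : ∀ m ∈ l, m ∈ l')
    (ht : Knows l t) : Knows l' t := by
  obtain ⟨m, hm, ht⟩ := ht
  exact ⟨m, h m hm, ht⟩

/-- Restricted to signed terms, since the encoding of a list adds pairs and a `data 0` of its own.
-/
theorem sign_mem_subterms_ofList {V : Type*} {l : List (Msg V)} {v : V} {a : Msg V} :
    Msg.sign v a ∈ (Msg.ofList l).subterms ↔ Knows l (Msg.sign v a) := by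
  induction l with
  | nil => simp [Msg.ofList, Msg.subterms, Knows]
  | cons m l ih => simp [Msg.ofList, Msg.subterms, Knows, ih]

/-! ### Root nodes and flooding -/

open Classical in
/-- The nodes of `V - F` from which all nodes of `V - F` can be reached in `G_F`. -/
noncomputable def roots {V : Type*} [Fintype V] (G : Digraph V) (F : Finset V) : Finset V :=
  {u | u ∉ F ∧ ∀ v ∉ F, u ∈ reach G F v}

theorem mem_roots {V : Type*} [Fintype V] {G : Digraph V} {F : Finset V} {u : V} :
    u ∈ roots G F ↔ u ∉ F ∧ ∀ v ∉ F, u ∈ reach G F v := by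
  simp [roots]

/-- A smallest reach set consists of roots. If `w` lies in it and in `reach G F v`, then `reach G F
w` is contained in it, hence equal to it by minimality, and all of it reaches `v` through `w`. -/
theorem lt_card_roots {V : Type*} [Fintype V] {G : Digraph V} {f : ℕ} (hn : f < Fintype.card V)
    (hG : OneReach G f (f + 1)) {F : Finset V} (hF : F.card ≤ f) : f < (roots G F).card := by
  classical
  have hne : (Fᶜ).Nonempty := by
    rw [← Finset.card_pos, Finset.card_compl]
    omega
  obtain ⟨u, hu, hmin⟩ := Finset.exists_min_image Fᶜ (fun u => (reach G F u).ncard) hne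
  simp only [Finset.mem_compl] at hu hmin
  have hsub : reach G F u ⊆ roots G F := by
    intro z hz
    refine mem_roots.2 ⟨hz.1, fun v hv => ?_⟩
    have hpos : 0 < (reach G F u ∩ reach G F v).ncard := by
      have := hG F hF u v hu hv
      omega
    obtain ⟨w, hwu, hwv⟩ := Set.nonempty_of_ncard_ne_zero hpos.ne'
    have hwsub : reach G F w ⊆ reach G F u := fun a ha => ⟨ha.1, ha.2.trans hwu.2⟩
    have heq := Set.eq_of_subset_of_ncard_le hwsub (hmin w hwu.1)
    rw [← heq] at hz
    exact ⟨hz.1, hz.2.trans hwv.2⟩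
  have h₁ := hG F hF u u hu hu
  rw [Set.inter_self] at h₁
  have h₂ := Set.ncard_le_ncard hsub
  rw [Set.ncard_coe_finset] at h₂
  omega

/-- `N` rounds suffice to spread a new announcement among the nonfaulty nodes. -/
def IsFloodingTime {V : Type*} (G : Digraph V) (N : ℕ) : Prop :=
  ∃ M, N = M + 1 ∧ ∀ (F : Finset V) (u w : V),
    Relation.ReflTransGen (removeNodes G F).Adj u w →
      ∀ Q : ℕ → V → Prop, (∀ r v, Q r v → Q (r + 1) v) →
        (∀ r a b, (removeNodes G F).Adj a b → Q r a → Q (r + 1) b) →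
        ∀ r, Q r u → Q (r + M) w

theorem IsFloodingTime.pos {V : Type*} {G : Digraph V} {N : ℕ}
    (hN : IsFloodingTime G N) : 0 < N := by
  obtain ⟨M, rfl, -⟩ := hN
  exact M.succ_pos

/-- A uniform bound on the time that flooding takes. -/
theorem exists_flooding_time {V : Type*} [Fintype V] (G : Digraph V) :
    ∃ N : ℕ, ∀ (F : Finset V) (u w : V), Relation.ReflTransGen (removeNodes G F).Adj u w →
      ∀ P : ℕ → V → Prop, (∀ r v, P r v → P (r + 1) v) →
        (∀ r a b, (removeNodes G F).Adj a b → P r a → P (r + 1) b) →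
        ∀ r, P r u → P (r + N) w := by
  have key : ∀ p : Finset V × V × V, ∃ N : ℕ,
      Relation.ReflTransGen (removeNodes G p.1).Adj p.2.1 p.2.2 →
      ∀ P : ℕ → V → Prop, (∀ r a b, (removeNodes G p.1).Adj a b → P r a → P (r + 1) b) →
        ∀ r, P r p.2.1 → P (r + N) p.2.2 := by
    rintro ⟨F, u, w⟩
    by_cases h : Relation.ReflTransGen (removeNodes G F).Adj u w
    · simp only [h, forall_const]
      induction h with
      | refl => exact ⟨0, fun P _ r hr => hr⟩
      | tail _ hab ih =>
        obtain ⟨N, hN⟩ := ih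
        exact ⟨N + 1, fun P hP r hr => hP _ _ _ hab (hN P hP r hr)⟩
    · exact ⟨0, fun h' => absurd h' h⟩
  choose N hN using key
  refine ⟨Finset.univ.sup N, fun F u w h P hmono hP r hr => ?_⟩
  have h₁ := hN (F, u, w) h P hP r hr
  have hle : r + N (F, u, w) ≤ r + Finset.univ.sup N := by
    have := Finset.le_sup (f := N) (Finset.mem_univ (F, u, w))
    omega
  exact Nat.le_induction (P := fun k _ => P k w) h₁ (fun k _ hk => hmono k w hk) _ hle

/-! ### The algorithm -/

/-- The contents of an announcement as a number: the round, the current value, and the set of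
values that have been heard of. -/
noncomputable def announcementCode {V : Type*} [Fintype V] :
    ℕ × Bool × Finset (V × Bool) → ℕ :=
  Classical.choose (exists_injective_nat (ℕ × Bool × Finset (V × Bool)))

theorem announcementCode_injective {V : Type*} [Fintype V] :
    Function.Injective (announcementCode (V := V)) :=
  Classical.choose_spec (exists_injective_nat (ℕ × Bool × Finset (V × Bool)))

/-- In round `r`, node `v` announces that it has value `b` and has heard of the values in `E`. -/
noncomputable def announcement {V : Type*} [Fintype V] (v : V) (r : ℕ) (b : Bool)
    (E : Finset (V × Bool)) : Msg V :=
  .sign v (.data (announcementCode (r, b, E)))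

theorem announcement_inj {V : Type*} [Fintype V] {v v' : V} {r r' : ℕ} {b b' : Bool}
    {E E' : Finset (V × Bool)} :
    announcement v r b E = announcement v' r' b' E' ↔ v = v' ∧ r = r' ∧ b = b' ∧ E = E' := by
  simp [announcement, announcementCode_injective.eq_iff]

theorem announcement_mem_subterms_announcement {V : Type*} [Fintype V] {v v' : V} {r r' : ℕ}
    {b b' : Bool} {E E' : Finset (V × Bool)} :
    announcement v r b E ∈ (announcement v' r' b' E').subterms ↔
      v = v' ∧ r = r' ∧ b = b' ∧ E = E' := by
  rw [← announcement_inj]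
  simp [announcement, Msg.subterms]

open Classical in
/-- The values announced in round `t` that can be read from `l`. -/
noncomputable def heardValues {V : Type*} [Fintype V] (t : ℕ) (l : List (Msg V)) :
    Finset (V × Bool) :=
  {p | ∃ E, Knows l (announcement p.1 t p.2 E)}

theorem mem_heardValues {V : Type*} [Fintype V] {t : ℕ} {l : List (Msg V)} {s : V} {b : Bool} :
    (s, b) ∈ heardValues t l ↔ ∃ E, Knows l (announcement s t b E) := by
  simp [heardValues]

open Classical in
/-- The values announced in round `t` which can be read from `l` and which a node of `R` reports
in round `t'`. -/
noncomputable def reportedValues {V : Type*} [Fintype V] (R : Finset V) (t t' : ℕ)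
    (l : List (Msg V)) : Finset (V × Bool) :=
  {p ∈ heardValues t l | ∃ h ∈ R, ∃ b E, Knows l (announcement h t' b E) ∧ p ∈ E}

theorem mem_reportedValues {V : Type*} [Fintype V] {R : Finset V} {t t' : ℕ} {l : List (Msg V)}
    {p : V × Bool} : p ∈ reportedValues R t t' l ↔
      p ∈ heardValues t l ∧ ∃ h ∈ R, ∃ b E, Knows l (announcement h t' b E) ∧ p ∈ E := by
  simp [reportedValues]

open Classical in
/-- The nodes for which `E` contains the value `b` and no other value. -/
noncomputable def supporters {V : Type*} [Fintype V] (E : Finset (V × Bool)) (b : Bool) :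
    Finset V :=
  {s | (s, b) ∈ E ∧ (s, !b) ∉ E}

theorem mem_supporters {V : Type*} [Fintype V] {E : Finset (V × Bool)} {b : Bool} {s : V} :
    s ∈ supporters E b ↔ (s, b) ∈ E ∧ (s, !b) ∉ E := by
  simp [supporters]

/-- The value with most supporters. -/
noncomputable def majority {V : Type*} [Fintype V] (E : Finset (V × Bool)) : Bool :=
  decide ((supporters E false).card < (supporters E true).card)

theorem majority_eq {V : Type*} [Fintype V] {E : Finset (V × Bool)} {b : Bool}
    (h : (supporters E !b).card < (supporters E b).card) : majority E = b := by
  cases b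
  · simpa [majority] using h.le
  · simpa [majority] using h

open Classical in
/-- The new value of a node at the end of a phase: the majority of the values of round `t` that
the nodes of `R` report in round `t'`, provided that all nodes of `R` have reported. -/
noncomputable def updatedValue {V : Type*} [Fintype V] (R : Finset V) (t t' : ℕ)
    (l : List (Msg V)) (old : Bool) : Bool :=
  if ∀ h ∈ R, ∃ b E, Knows l (announcement h t' b E) then majority (reportedValues R t t' l)
  else old

/-- The local state of a node. -/
structure NodeState (V : Type*) where
  round : ℕ
  seen : List (Msg V)
  val : Bool

/-- What node `v` sends in state `σ`, as a list. -/
noncomputable def NodeState.outgoing {V : Type*} [Fintype V] (N : ℕ) (v : V) (σ : NodeState V) :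
    List (Msg V) :=
  announcement v σ.round σ.val (heardValues (σ.round - N) σ.seen) :: σ.seen

open Classical in
/-- One round of node `v`. A phase has `2 * N` rounds, and phase `p` assumes that the nodes of
`sched p` are faulty. -/
noncomputable def NodeState.step {V : Type*} [Fintype V] (G : Digraph V) (N : ℕ)
    (sched : ℕ → Finset V) (v : V) (σ : NodeState V) (i : Inbox V) : NodeState V where
  round := σ.round + 1
  seen := σ.outgoing N v ++ (Finset.univ : Finset V).toList.filterMap i
  val :=
    -- True in the last round of a phase: the values date from its first round, the reports from `N`
    -- rounds later.
    if 2 * N ∣ σ.round + 1 then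
      updatedValue (roots G (sched (σ.round / (2 * N)))) (σ.round + 1 - 2 * N)
        (σ.round + 1 - N) (σ.outgoing N v ++ (Finset.univ : Finset V).toList.filterMap i) σ.val
    else σ.val

/-- The state of node `v` with input `b` after the inboxes in `h`. -/
noncomputable def nodeState {V : Type*} [Fintype V] (G : Digraph V) (N : ℕ)
    (sched : ℕ → Finset V) (v : V) (b : Bool) (h : List (Inbox V)) : NodeState V :=
  h.foldl (NodeState.step G N sched v) ⟨0, [], b⟩

theorem nodeState_append {V : Type*} [Fintype V] (G : Digraph V) (N : ℕ)
    (sched : ℕ → Finset V) (v : V) (b : Bool) (h : List (Inbox V)) (i : Inbox V) :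
    nodeState G N sched v b (h ++ [i]) =
      (nodeState G N sched v b h).step G N sched v i := by
  simp [nodeState]

theorem nodeState_round {V : Type*} [Fintype V] (G : Digraph V) (N : ℕ)
    (sched : ℕ → Finset V) (v : V) (b : Bool) (h : List (Inbox V)) :
    (nodeState G N sched v b h).round = h.length := by
  induction h using List.reverseRecOn with
  | nil => rfl
  | append_singleton h i ih => simp [nodeState_append, NodeState.step, ih]

theorem received_append_left {V : Type*} (h h' : List (Inbox V)) :
    received h ⊆ received (h ++ h') := by
  rintro m ⟨i, hi, hm⟩
  exact ⟨i, List.mem_append_left _ hi, hm⟩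

theorem derivable_outgoing {V : Type*} [Fintype V] (G : Digraph V) (N : ℕ)
    (sched : ℕ → Finset V) (v : V) (b : Bool) (h : List (Inbox V)) :
    ∀ m ∈ (nodeState G N sched v b h).outgoing N v, Derivable {v} (received h) m := by
  have cons : ∀ (S : Set (Msg V)) (σ : NodeState V), (∀ m ∈ σ.seen, Derivable {v} S m) →
      ∀ m ∈ σ.outgoing N v, Derivable {v} S m := by
    intro S σ hσ m hm
    rcases List.mem_cons.1 hm with rfl | hm
    · exact .sign rfl (.data _)
    · exact hσ m hm
  refine cons _ _ ?_
  induction h using List.reverseRecOn with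
  | nil => simp [nodeState]
  | append_singleton h i ih =>
    intro m hm
    rw [nodeState_append] at hm
    rcases List.mem_append.1 hm with hm | hm
    · exact (cons _ _ ih m hm).trans subset_rfl
        fun a ha => .known (received_append_left _ _ ha)
    · obtain ⟨u, -, hu⟩ := List.mem_filterMap.1 hm
      exact .known ⟨i, by simp, u, hu⟩

/-- The consensus algorithm with `P` phases of `2 * N` rounds. -/
noncomputable def phaseAlgorithm {V : Type*} [Fintype V] (G : Digraph V) (N : ℕ)
    (sched : ℕ → Finset V) (P : ℕ) : SyncAlgorithm V where
  send v b h _ := some (Msg.ofList ((nodeState G N sched v b h).outgoing N v))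
  decide v b h := if h.length = 2 * N * P then some (nodeState G N sched v b h).val else none
  send_derivable v b h w m hm := by
    obtain rfl := Option.some.inj hm
    exact .ofList (derivable_outgoing G N sched v b h)

/-! ### Correctness: local states, unforgeability and flooding -/

section Correctness

variable {V : Type*} [Fintype V] {G : Digraph V} {N P : ℕ} {sched : ℕ → Finset V} {F : Finset V}
  {x : V → Bool} {T : Transcript V}

/-- The state of node `v` at the beginning of round `r`. -/
noncomputable def stateAt (G : Digraph V) (N : ℕ) (sched : ℕ → Finset V) (x : V → Bool)
    (T : Transcript V) (v : V) (r : ℕ) : NodeState V :=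
  nodeState G N sched v (x v) (history T v r)

local notation "St" => stateAt G N sched x T

theorem stateAt_round (v : V) (r : ℕ) : (St v r).round = r := by
  simp [stateAt, nodeState_round, history]

theorem stateAt_succ (v : V) (r : ℕ) :
    St v (r + 1) = (St v r).step G N sched v fun u => T r u v := by
  rw [stateAt, history_succ, nodeState_append]
  rfl

theorem mem_seen_succ {v : V} {r : ℕ} {m : Msg V} :
    m ∈ (St v (r + 1)).seen ↔ m ∈ (St v r).outgoing N v ∨ ∃ u, T r u v = some m := by
  simp [stateAt_succ, NodeState.step]

theorem val_succ (v : V) (r : ℕ) : (St v (r + 1)).val =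
    if 2 * N ∣ r + 1 then updatedValue (roots G (sched (r / (2 * N)))) (r + 1 - 2 * N)
      (r + 1 - N) (St v (r + 1)).seen (St v r).val else (St v r).val := by
  simp only [stateAt_succ, NodeState.step, stateAt_round]

/-- The announcement of node `v` in round `r`. -/
noncomputable def announcementAt (G : Digraph V) (N : ℕ) (sched : ℕ → Finset V) (x : V → Bool)
    (T : Transcript V) (v : V) (r : ℕ) : Msg V :=
  announcement v r (stateAt G N sched x T v r).val
    (heardValues (r - N) (stateAt G N sched x T v r).seen)

theorem outgoing_eq (v : V) (r : ℕ) :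
    (St v r).outgoing N v = announcementAt G N sched x T v r :: (St v r).seen := by
  rw [NodeState.outgoing, announcementAt, stateAt_round]

theorem knows_succ {v : V} {r : ℕ} {t : Msg V} (h : Knows (St v r).seen t) :
    Knows (St v (r + 1)).seen t :=
  h.mono fun m hm => mem_seen_succ.2 (.inl (by simp [outgoing_eq, hm]))

theorem knows_mono {v : V} {r s : ℕ} (hrs : r ≤ s) {t : Msg V} (h : Knows (St v r).seen t) :
    Knows (St v s).seen t :=
  Nat.le_induction (P := fun k _ => Knows (St v k).seen t) h (fun _ _ hk => knows_succ hk) s hrs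

theorem knows_announcementAt (v : V) (r : ℕ) :
    Knows (St v (r + 1)).seen (announcementAt G N sched x T v r) :=
  ⟨_, mem_seen_succ.2 (.inl (by simp [outgoing_eq])), Msg.self_mem_subterms _⟩

theorem eq_of_nonfaulty (hT : IsExecution G (phaseAlgorithm G N sched P) F x T) {u w : V}
    (hu : u ∉ F) {r : ℕ} {m : Msg V} (hm : T r u w = some m) :
    m = Msg.ofList ((St u r).outgoing N u) := by
  by_cases huw : G.Adj u w
  · rw [hT.nonfaulty r u w hu huw] at hm
    exact (Option.some.inj hm).symm
  · simp [hT.no_link r u w huw] at hm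

theorem knows_of_adj (hT : IsExecution G (phaseAlgorithm G N sched P) F x T) {u w : V}
    (huw : (removeNodes G F).Adj u w) {r : ℕ} {a : V} {t : Msg V}
    (h : Knows (St u r).seen (.sign a t)) : Knows (St w (r + 1)).seen (.sign a t) := by
  refine ⟨_, mem_seen_succ.2 (.inr ⟨u, hT.nonfaulty r u w huw.2.1 huw.1⟩), ?_⟩
  refine sign_mem_subterms_ofList.2 (h.mono fun m hm => ?_)
  change m ∈ (St u r).outgoing N u
  simp [outgoing_eq, hm]

/-- The announcements of nonfaulty nodes are never forged. -/
theorem eq_of_knows_announcement (hT : IsExecution G (phaseAlgorithm G N sched P) F x T) {v : V}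
    (hv : v ∉ F) {t : ℕ} {b : Bool} {E : Finset (V × Bool)} (r : ℕ) :
    ∀ w ∉ F, Knows (St w r).seen (announcement v t b E) →
      b = (St v t).val ∧ E = heardValues (t - N) (St v t).seen := by
  induction r using Nat.strong_induction_on with
  | _ r ih =>
    have hout : ∀ s < r, ∀ u ∉ F, Knows ((St u s).outgoing N u) (announcement v t b E) →
        b = (St v t).val ∧ E = heardValues (t - N) (St v t).seen := by
      rintro s hs u hu ⟨m, hm, hmem⟩
      rw [outgoing_eq, List.mem_cons] at hm
      rcases hm with rfl | hm
      · obtain ⟨rfl, rfl, h⟩ := announcement_mem_subterms_announcement.1 hmem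
        exact h
      · exact ih s hs u hu ⟨m, hm, hmem⟩
    rintro w hw ⟨m, hm, hmem⟩
    cases r with
    | zero => simp [stateAt, history, nodeState] at hm
    | succ r =>
      rcases mem_seen_succ.1 hm with hm | ⟨u, hu⟩
      · exact hout r r.lt_succ_self w hw ⟨m, hm, hmem⟩
      by_cases huF : u ∈ F
      · obtain ⟨m', ⟨s, hs, u', hu', w', -, hsent⟩, hmem'⟩ :=
          (hT.faulty r u w m huF hu).exists_of_sign_mem_subterms (by simpa using hv) hmem
        rw [eq_of_nonfaulty hT hu' hsent] at hmem'
        exact hout s (Nat.lt_succ_of_le hs) u' hu' (sign_mem_subterms_ofList.1 hmem')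
      · rw [eq_of_nonfaulty hT huF hu] at hmem
        exact hout r r.lt_succ_self u huF (sign_mem_subterms_ofList.1 hmem)

theorem knows_of_mem_reach (hN : IsFloodingTime G N)
    (hT : IsExecution G (phaseAlgorithm G N sched P) F x T) {u w a : V} (hu : u ∈ reach G F w)
    {r : ℕ} {t : Msg V} (h : Knows (St u r).seen (.sign a t)) :
    Knows (St w (r + N)).seen (.sign a t) := by
  obtain ⟨M, hM, hflood⟩ := hN
  exact knows_mono (by omega) (hflood F u w hu.2 (fun r v => Knows (St v r).seen (.sign a t))
    (fun _ _ h => knows_succ h) (fun _ _ _ hab h => knows_of_adj hT hab h) r h)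

/-- The author itself stores its announcement only from `r + 1` on; this is the extra round in `N =
M + 1`. -/
theorem knows_announcementAt_of_mem_reach (hN : IsFloodingTime G N)
    (hT : IsExecution G (phaseAlgorithm G N sched P) F x T) {u w : V} (hu : u ∈ reach G F w)
    (r : ℕ) : Knows (St w (r + N)).seen (announcementAt G N sched x T u r) := by
  obtain ⟨M, hM, hflood⟩ := hN
  have := hflood F u w hu.2
    (fun s v => Knows (St v s).seen (announcementAt G N sched x T u r))
    (fun _ _ h => knows_succ h) (fun _ _ _ hab h => knows_of_adj hT hab h) (r + 1)
    (knows_announcementAt u r)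
  exact knows_mono (by omega) this

/-- A phase does not destroy unanimity. -/
theorem updatedValue_of_unanimous {f : ℕ} (hn : f < Fintype.card V)
    (hG : OneReach G f (f + 1)) (hN : IsFloodingTime G N)
    (hT : IsExecution G (phaseAlgorithm G N sched P) F x T) (hF : F.card ≤ f) {F' : Finset V}
    (hF' : F'.card ≤ f) {t : ℕ} {c : Bool} (hc : ∀ v ∉ F, (St v t).val = c) {u : V} (hu : u ∉ F) :
    updatedValue (roots G F') t (t + N) (St u (t + N + N)).seen c = c := by
  rw [updatedValue]
  split_ifs with hcomplete
  swap
  · rfl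
  -- The candidate `F'` may be wrong, but its more than `f` roots cannot all be faulty.
  obtain ⟨h, hh, hhF⟩ : ∃ h ∈ roots G F', h ∉ F :=
    Finset.exists_mem_notMem_of_card_lt_card (hF.trans_lt (lt_card_roots hn hG hF'))
  obtain ⟨b, E, hbE⟩ := hcomplete h hh
  obtain ⟨-, rfl⟩ := eq_of_knows_announcement hT hhF _ u hu hbE
  rw [Nat.add_sub_cancel] at hbE
  have hvalid : ∀ s ∉ F, ∀ b, (s, b) ∈ reportedValues (roots G F') t (t + N)
      (St u (t + N + N)).seen → b = c := by
    intro s hs b hb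
    obtain ⟨E, hE⟩ := mem_heardValues.1 (mem_reportedValues.1 hb).1
    rw [(eq_of_knows_announcement hT hs _ u hu hE).1, hc s hs]
  apply majority_eq
  -- Only faulty nodes can support `!c`. The roots for the true `F` all support `c`, because their
  -- values reach `h` before it reports.
  calc _ ≤ F.card := Finset.card_le_card fun s hs => by
        by_contra hsF
        simpa using hvalid s hsF _ (mem_supporters.1 hs).1
    _ ≤ f := hF
    _ < (roots G F).card := lt_card_roots hn hG hF
    _ ≤ _ := Finset.card_le_card fun s hs => by
        obtain ⟨hsF, hreach⟩ := mem_roots.1 hs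
        have hheard : ∀ w ∉ F, (s, c) ∈ heardValues t (St w (t + N)).seen := fun w hw =>
          mem_heardValues.2 ⟨_, by
            simpa only [announcementAt, hc s hsF] using
              knows_announcementAt_of_mem_reach hN hT (hreach w hw) t⟩
        refine mem_supporters.2 ⟨mem_reportedValues.2 ⟨?_, h, hh, b, _, hbE, hheard h hhF⟩,
          fun hs' => by simpa using hvalid s hsF _ hs'⟩
        obtain ⟨E, hE⟩ := mem_heardValues.1 (hheard u hu)
        exact mem_heardValues.2 ⟨E, knows_mono (Nat.le_add_right _ _) hE⟩

/-- The phase that assumes the actual set of faulty nodes achieves agreement. -/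
theorem updatedValue_of_faulty (hN : IsFloodingTime G N)
    (hT : IsExecution G (phaseAlgorithm G N sched P) F x T) (t : ℕ) :
    ∃ c, ∀ u ∉ F, ∀ old,
      updatedValue (roots G F) t (t + N) (St u (t + N + N)).seen old = c := by
  classical
  -- The common value is the majority of everything that the roots, all honest here, had heard by
  -- round `t + N`.
  refine ⟨majority ((roots G F).biUnion fun h => heardValues t (St h (t + N)).seen),
    fun u hu old => ?_⟩
  have hreport : ∀ h ∈ roots G F, Knows (St u (t + N + N)).seen
      (announcement h (t + N) (St h (t + N)).val (heardValues t (St h (t + N)).seen)) := by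
    intro h hh
    simpa only [announcementAt, Nat.add_sub_cancel] using
      knows_announcementAt_of_mem_reach hN hT ((mem_roots.1 hh).2 u hu) (t + N)
  rw [updatedValue, if_pos fun h hh => ⟨_, _, hreport h hh⟩]
  congr 1
  ext ⟨s, b⟩
  rw [mem_reportedValues, Finset.mem_biUnion]
  constructor
  · rintro ⟨-, h, hh, b', E, hE, hmem⟩
    obtain ⟨-, rfl⟩ := eq_of_knows_announcement hT (mem_roots.1 hh).1 _ u hu hE
    rw [Nat.add_sub_cancel] at hmem
    exact ⟨h, hh, hmem⟩
  -- What a root has heard it also relays in the second half of the phase, so the original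
  -- signatures reach `u` along with the report.
  · rintro ⟨h, hh, hmem⟩
    obtain ⟨E, hE⟩ := mem_heardValues.1 hmem
    exact ⟨mem_heardValues.2 ⟨E, knows_of_mem_reach hN hT ((mem_roots.1 hh).2 u hu) hE⟩,
      h, hh, _, _, hreport h hh, hmem⟩

/-! ### From single phases to the whole run -/

theorem val_end_of_phase (hN : 0 < N) (v : V) (p : ℕ) : ∃ r, r + 1 = 2 * N * (p + 1) ∧
    (St v (2 * N * (p + 1))).val = updatedValue (roots G (sched p)) (2 * N * p) (2 * N * p + N)
      (St v (2 * N * p + N + N)).seen (St v r).val := by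
  obtain ⟨r, hr⟩ : ∃ r, r + 1 = 2 * N * (p + 1) :=
    ⟨2 * N * (p + 1) - 1, Nat.sub_add_cancel (Nat.mul_pos (by omega) p.succ_pos)⟩
  have he : 2 * N * (p + 1) = 2 * N * p + N + N := by ring
  refine ⟨r, hr, ?_⟩
  have hp : r / (2 * N) = p := by
    rw [Nat.div_eq_iff (by positivity)]
    constructor
    · rw [mul_comm]; omega
    · rw [mul_comm p]; omega
  rw [← hr, val_succ, if_pos (hr ▸ Nat.dvd_mul_right _ _), hp,
    show r + 1 - 2 * N = 2 * N * p by omega,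
    show r + 1 - N = 2 * N * p + N by omega, show r + 1 = 2 * N * p + N + N by omega]

/-- Strong induction is needed because the value at the end of a phase depends on the values at its
start, `2 * N` rounds earlier. -/
theorem unanimous_of_le {f : ℕ} (hn : f < Fintype.card V)
    (hG : OneReach G f (f + 1)) (hN : IsFloodingTime G N) (hsched : ∀ p, (sched p).card ≤ f)
    (hT : IsExecution G (phaseAlgorithm G N sched P) F x T) (hF : F.card ≤ f) {p : ℕ} {c : Bool}
    (hc : ∀ v ∉ F, (St v (2 * N * p)).val = c) (r : ℕ) :
    2 * N * p ≤ r → ∀ v ∉ F, (St v r).val = c := by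
  induction r using Nat.strong_induction_on with
  | _ r ih =>
    intro hr v hv
    rcases hr.eq_or_lt with rfl | hlt
    · exact hc v hv
    obtain ⟨r, rfl⟩ : ∃ k, r = k + 1 := ⟨r - 1, by omega⟩
    by_cases hd : 2 * N ∣ r + 1
    · obtain ⟨q, hq⟩ := hd
      obtain ⟨q, rfl⟩ : ∃ k, q = k + 1 := ⟨q - 1, by
        cases q with
        | zero => simp at hq
        | succ q => simp⟩
      have hpq : p ≤ q := by
        rw [hq] at hlt
        exact Nat.lt_succ_iff.1 (lt_of_mul_lt_mul_left' hlt)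
      obtain ⟨r', hr', hval⟩ := val_end_of_phase (G := G) (sched := sched) (x := x) (T := T)
        hN.pos v q
      obtain rfl : r' = r := by omega
      rw [hq, hval, ih r' (by omega) (by omega) v hv]
      have hpos := hN.pos
      exact updatedValue_of_unanimous hn hG hN hT hF (hsched q)
        (ih _ (by rw [hq, mul_add]; omega) (Nat.mul_le_mul_left _ hpq)) hv
    · rw [val_succ, if_neg hd]
      exact ih r r.lt_succ_self (by omega) v hv

theorem outputs_iff {v : V} {b : Bool} : Outputs (phaseAlgorithm G N sched P) x T v b ↔
    (St v (2 * N * P)).val = b := by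
  have hlen : ∀ r, (history T v r).length = r := fun r => by simp [history]
  simp only [Outputs, phaseAlgorithm, hlen]
  constructor
  · rintro ⟨r, hr, -⟩
    split_ifs at hr with h
    subst h
    exact Option.some.inj hr
  · rintro rfl
    exact ⟨2 * N * P, by simp [stateAt], fun s hs => if_neg hs.ne⟩

theorem phaseAlgorithm_solvesConsensus {f : ℕ} (hn : f < Fintype.card V)
    (hG : OneReach G f (f + 1)) (hN : IsFloodingTime G N) (hsched : ∀ p, (sched p).card ≤ f)
    (hP : ∀ F : Finset V, F.card ≤ f → ∃ p < P, sched p = F) :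
    SolvesConsensus G f (phaseAlgorithm G N sched P) := by
  intro F x T hF hT
  simp only [outputs_iff]
  refine ⟨fun v _ => ⟨_, rfl⟩, ?_, ?_⟩
  · rintro v hv b hb
    by_contra! h
    -- Inputs are binary: if no nonfaulty node has input `b`, the nonfaulty nodes start unanimously
    -- with `!b` and stay so.
    have := unanimous_of_le hn hG hN hsched hT hF (p := 0) (c := !b)
      (fun u hu => by simpa [stateAt, nodeState, history, Bool.eq_not] using h u hu)
      (2 * N * P) (by simp) v hv
    simp [hb] at this
  · rintro u hu v hv b c rfl rfl
    -- The phase whose candidate is the true fault set creates agreement; the later phases preserve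
    -- it.
    obtain ⟨p, hp, rfl⟩ := hP F hF
    obtain ⟨c, hc⟩ := updatedValue_of_faulty hN hT (2 * N * p)
    have hend : ∀ w ∉ sched p, (stateAt G N sched x T w (2 * N * (p + 1))).val = c := by
      intro w hw
      obtain ⟨r, -, hr⟩ := val_end_of_phase (G := G) (sched := sched) (x := x) (T := T) hN.pos w p
      rw [hr, hc w hw]
    have hfin := unanimous_of_le hn hG hN hsched hT hF hend (2 * N * P) (Nat.mul_le_mul_left _ hp)
    rw [hfin u hu, hfin v hv]

end Correctness

theorem syncConsensusPossible_of_oneReach {V : Type*} [Fintype V] {G : Digraph V} {f : ℕ}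
    (hn : f < Fintype.card V) (hG : OneReach G f (f + 1)) : SyncConsensusPossible G f := by
  obtain ⟨M, hM⟩ := exists_flooding_time G
  have : Nonempty {F : Finset V // F.card ≤ f} := ⟨⟨∅, by simp⟩⟩
  obtain ⟨sched, hsched⟩ := exists_surjective_nat {F : Finset V // F.card ≤ f}
  choose idx hidx using hsched
  obtain ⟨P, hP⟩ := (Set.finite_range idx).bddAbove
  exact ⟨phaseAlgorithm G (M + 1) (fun p => (sched p).1) (P + 1),
    phaseAlgorithm_solvesConsensus hn hG ⟨M, rfl, hM⟩ (fun p => (sched p).2) fun F hF =>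
      ⟨idx ⟨F, hF⟩, Nat.lt_succ_of_le (hP ⟨_, rfl⟩), by rw [hidx]⟩⟩

theorem mainTheorem3 {V : Type*} [Fintype V] (G : Digraph V) (f : ℕ)
    (hf : 0 < f) (hn : f < Fintype.card V) :
    SyncConsensusPossible G f ↔ OneReach G f (f + 1) :=
  ⟨fun ⟨_, hA⟩ => oneReach_of_solvesConsensus hn hA, syncConsensusPossible_of_oneReach hn⟩
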